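/- Let $a=(a_1,a_2,\dots)$ and $b=(b_1,b_2,\dots)$ be sequences of integers $\ge 2$, and let $a\cdot b=(a_1b_1,a_2b_2,\dots)$. Let $\mathcal A_n(a)=M_{a_1}(\mathbb C)\otimes\cdots\otimes M_{a_n}(\mathbb C)$ and let $\mathcal A(a)=\varinjlim \mathcal A_n(a)$ be the UHF C*-algebra obtained from the embeddings $x\mapsto x\otimes 1$. Let $\otimes$ denote the minimal tensor product of C*-algebras, and let $\varphi_{a,b}:\mathcal A(a\cdot b)\to\mathcal A(a)\otimes\mathcal A(b)$ be the $*$-isomorphism determined on matrix units by $$\varphi_{a,b}\big(E^{(a_1b_1)}_{j_1,k_1}\otimes\cdots\otimes E^{(a_nb_n)}_{j_n,k_n}\big)=\big(E^{(a_1)}_{j_1',k_1'}\otimes\cdots\otimes E^{(a_n)}_{j_n',k_n'}\big)\otimes\big(E^{(b_1)}_{j_1'',k_1''}\otimes\cdots\otimes E^{(b_n)}_{j_n'',k_n''}\big),$$ where $j_i=b_i(j_i'-1)+j_i''$, $k_i=b_i(k_i'-1)+k_i''$ with $1\le j_i',k_i'\le a_i$ and $1\le j_i'',k_i''\le b_i$.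 For states $\rho_1$ of $\mathcal A(a)$ and $\rho_2$ of $\mathcal A(b)$ put $\rho_1\otimes_\varphi\rho_2=(\rho_1\otimes\rho_2)\circ\varphi_{a,b}$, and for $*$-representations $\pi_1$ of $\mathcal A(a)$ and $\pi_2$ of $\mathcal A(b)$ put $\pi_1\otimes_\varphi\pi_2=(\pi_1\otimes\pi_2)\circ\varphi_{a,b}$. For a sequence $\mathbf T=(T^{(n)})_{n\ge1}$ of positive semidefinite matrices $T^{(n)}\in M_{a_n}(\mathbb C)$ of trace $1$, let $\omega_{\mathbf T}$ be the product state of $\mathcal A(a)$ with $$\omega_{\mathbf T}\big(E^{(a_1)}_{j_1,k_1}\otimes\cdots\otimes E^{(a_n)}_{j_n,k_n}\big)=T^{(1)}_{k_1,j_1}\cdots T^{(n)}_{k_n,j_n},$$ and let $\pi_{\mathbf T}$ be its GNS representation. **Theorem.** Let $\mathbf T=(T^{(n)})$ and $\mathbf R=(R^{(n)})$ be sequences of positive semidefinite matrices of trace $1$ with $T^{(n)}\in M_{a_n}(\mathbb C)$ and $R^{(n)}\in M_{b_n}(\mathbb C)$, and let $\mathbf T\boxtimes\mathbf R=(T^{(n)}\boxtimes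 R^{(n)})_{n\ge 1}$ be the sequence of Kronecker products, $(A\boxtimes B)_{m(i-1)+i',\,m(j-1)+j'}=A_{i,j}B_{i',j'}$ for $B\in M_m(\mathbb C)$. Then: (i) $\omega_{\mathbf T}\otimes_\varphi\omega_{\mathbf R}=\omega_{\mathbf T\boxtimes\mathbf R}$; (ii) $\pi_{\mathbf T}\otimes_\varphi\pi_{\mathbf R}$ is unitarily equivalent to $\pi_{\mathbf T\boxtimes\mathbf R}$. -/

import Mathlib

noncomputable section

namespace UHF

open UniformSpace
open scoped TensorProduct ComplexOrder

/-! ### C⋆-completions -/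

/-- A C⋆-seminorm on a complex ⋆-algebra. -/
structure CStarSeminorm (A : Type*) [Ring A] [StarRing A] [Algebra ℂ A] [StarModule ℂ A] where
  /-- the underlying seminorm -/
  toSeminorm : Seminorm ℂ A
  mul_le' : ∀ x y, toSeminorm (x * y) ≤ toSeminorm x * toSeminorm y
  le_star_mul_self' : ∀ x, toSeminorm x * toSeminorm x ≤ toSeminorm (star x * x)

namespace CStarSeminorm

variable {A : Type*} [Ring A] [StarRing A] [Algebra ℂ A] [StarModule ℂ A] (p : CStarSeminorm A)

/-- The algebra `A`, regarded as a seminormed algebra through `p`. -/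
def Space (_ : CStarSeminorm A) : Type _ := A

instance : Ring p.Space := inferInstanceAs (Ring A)
instance : StarRing p.Space := inferInstanceAs (StarRing A)
instance : Algebra ℂ p.Space := inferInstanceAs (Algebra ℂ A)
instance : StarModule ℂ p.Space := inferInstanceAs (StarModule ℂ A)

/-- The identity map from `A` to `p.Space`. -/
def toSpace : A ≃⋆ₐ[ℂ] p.Space := StarAlgEquiv.refl (R := ℂ) (A := A)

instance : SeminormedRing p.Space where
  __ := (inferInstance : Ring p.Space)
  __ := AddGroupSeminorm.toSeminormedAddCommGroup (E := p.Space) p.toSeminorm.toAddGroupSeminorm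
  norm_mul_le := p.mul_le'

lemma norm_toSpace (x : A) : ‖p.toSpace x‖ = p.toSeminorm x := rfl

instance : NormedAlgebra ℂ p.Space where
  norm_smul_le c x := by
    exact (map_smul_eq_mul p.toSeminorm c (p.toSpace.symm x)).le

lemma norm_mul_self_le (x : p.Space) : ‖x‖ * ‖x‖ ≤ ‖star x * x‖ := p.le_star_mul_self' x

lemma norm_star_le (x : p.Space) : ‖star x‖ ≤ ‖x‖ := by
  have h : ‖star x‖ * ‖star x‖ ≤ ‖x‖ * ‖star x‖ := by
    have h1 := p.norm_mul_self_le (star x)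
    rw [star_star] at h1
    exact h1.trans (norm_mul_le _ _)
  rcases (norm_nonneg (star x)).eq_or_lt with h0 | h0
  · rw [← h0]; exact norm_nonneg x
  · exact le_of_mul_le_mul_right h h0

instance : NormedStarGroup p.Space := ⟨p.norm_star_le⟩

instance : Star (Completion p.Space) := ⟨Completion.map (star : p.Space → p.Space)⟩

lemma uniformContinuous_star : UniformContinuous (star : p.Space → p.Space) :=
  (starₗᵢ ℂ (E := p.Space)).isometry.uniformContinuous

lemma star_coe (x : p.Space) : star (x : Completion p.Space) = ((star x : p.Space) : Completion p.Space) :=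
  Completion.map_coe p.uniformContinuous_star x

instance : ContinuousStar (Completion p.Space) := ⟨Completion.continuous_map⟩

instance : StarRing (Completion p.Space) where
  star_involutive x := by
    induction x using Completion.induction_on with
    | hp => apply isClosed_eq <;> fun_prop
    | ih x => simp [star_coe]
  star_mul x y := by
    induction x, y using Completion.induction_on₂ with
    | hp => apply isClosed_eq <;> fun_prop
    | ih x y => simp [star_coe, ← Completion.coe_mul]
  star_add x y := by
    induction x, y using Completion.induction_on₂ with
    | hp => apply isClosed_eq <;> fun_prop
    | ih x y => simp [star_coe, ← Completion.coe_add]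

instance : StarModule ℂ (Completion p.Space) where
  star_smul c x := by
    induction x using Completion.induction_on with
    | hp =>
      exact isClosed_eq (continuous_star.comp (continuous_const_smul c))
        (Continuous.const_smul continuous_star (star c))
    | ih x => simp [star_coe, ← Completion.coe_smul]

instance : CStarRing (Completion p.Space) where
  norm_mul_self_le x := by
    induction x using Completion.induction_on with
    | hp => apply isClosed_le <;> fun_prop
    | ih x => simpa [star_coe, ← Completion.coe_mul] using p.norm_mul_self_le x

instance : NormedAlgebra ℂ (Completion p.Space) where
  norm_smul_le := norm_smul_le

instance : CStarAlgebra (Completion p.Space) where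

/-- The canonical ⋆-homomorphism of `A` into its completion (auxiliary form). -/
def toComplAux : A →⋆ₐ[ℂ] Completion p.Space where
  toFun x := (p.toSpace x : Completion p.Space)
  map_one' := by simp [Completion.coe_one]
  map_mul' := by simp [Completion.coe_mul]
  map_zero' := by simp [Completion.coe_zero]
  map_add' := by simp [Completion.coe_add]
  commutes' c := by
    simp [Algebra.algebraMap_eq_smul_one, Completion.coe_one]
  map_star' x := by simp [star_coe, map_star]

/-- The C⋆-algebra obtained from `A` by completing it with respect to `p`
(the null space of `p` is divided out). -/
def Compl : Type _ := Completion p.Space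

instance : CStarAlgebra p.Compl := inferInstanceAs (CStarAlgebra (Completion p.Space))
instance : PartialOrder p.Compl := CStarAlgebra.spectralOrder p.Compl
instance : StarOrderedRing p.Compl := CStarAlgebra.spectralOrderedRing p.Compl

/-- The canonical ⋆-homomorphism of `A` into its completion. -/
def toCompl : A →⋆ₐ[ℂ] p.Compl := p.toComplAux

lemma norm_toCompl (x : A) : ‖p.toCompl x‖ = p.toSeminorm x :=
  Completion.norm_coe (p.toSpace x)

lemma denseRange_toCompl : DenseRange p.toCompl :=
  Completion.denseRange_coe.comp p.toSpace.surjective.denseRange (Completion.continuous_coe _)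

/-- The extension of a `p`-contractive linear map to the completion. -/
def extendL {E : Type*} [NormedAddCommGroup E] [NormedSpace ℂ E] [CompleteSpace E]
    (f : A →ₗ[ℂ] E) (hf : ∀ x, ‖f x‖ ≤ p.toSeminorm x) : p.Compl →L[ℂ] E :=
  ((f ∘ₗ (p.toSpace.symm : p.Space →ₗ[ℂ] A)).mkContinuous 1 (fun x => by
    rw [one_mul]; exact hf _)).fromCompletion

lemma extendL_toCompl {E : Type*} [NormedAddCommGroup E] [NormedSpace ℂ E] [CompleteSpace E]
    (f : A →ₗ[ℂ] E) (hf : ∀ x, ‖f x‖ ≤ p.toSeminorm x) (x : A) :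
    p.extendL f hf (p.toCompl x) = f x :=
  ContinuousLinearMap.fromCompletion_apply_coe
    ((f ∘ₗ (p.toSpace.symm : p.Space →ₗ[ℂ] A)).mkContinuous 1 (fun x => by
      rw [one_mul]; exact hf _)) (p.toSpace x)

/-- The extension of a `p`-contractive ⋆-homomorphism into a C⋆-algebra to the completion. -/
def extend {B : Type*} [CStarAlgebra B] (f : A →⋆ₐ[ℂ] B) (hf : ∀ x, ‖f x‖ ≤ p.toSeminorm x) :
    p.Compl →⋆ₐ[ℂ] B :=
  let F := p.extendL (f : A →ₐ[ℂ] B).toLinearMap hf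
  have hF (x : A) : F (p.toCompl x) = f x := p.extendL_toCompl _ hf x
  have h1 : F 1 = 1 := by rw [← map_one p.toCompl, hF, map_one]
  { toFun := F
    map_one' := h1
    map_mul' x y := by
      refine p.denseRange_toCompl.induction_on₂ (p := fun x y => F (x * y) = F x * F y)
        (isClosed_eq (by fun_prop) (by fun_prop)) (fun a b => ?_) x y
      rw [← map_mul, hF, hF, hF, map_mul]
    map_zero' := map_zero F
    map_add' := map_add F
    commutes' c := by
      rw [Algebra.algebraMap_eq_smul_one, map_smul, h1, Algebra.algebraMap_eq_smul_one]
    map_star' x := by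
      refine p.denseRange_toCompl.induction_on (p := fun x => F (star x) = star (F x)) x
        (isClosed_eq (by fun_prop) (by fun_prop)) (fun a => ?_)
      rw [← map_star, hF, hF, map_star] }

lemma extend_toCompl {B : Type*} [CStarAlgebra B] (f : A →⋆ₐ[ℂ] B)
    (hf : ∀ x, ‖f x‖ ≤ p.toSeminorm x) (x : A) : p.extend f hf (p.toCompl x) = f x :=
  p.extendL_toCompl _ hf x

end CStarSeminorm

/-! ### States -/

/-- States of a unital C⋆-algebra: positive linear functionals `f` with `f 1 = 1`. -/
structure State (A : Type*) [CStarAlgebra A] [PartialOrder A] [StarOrderedRing A] where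
  /-- the underlying positive linear functional -/
  toPositive : A →ₚ[ℂ] ℂ
  map_one' : toPositive 1 = 1

namespace State

section
variable {A : Type*} [CStarAlgebra A] [PartialOrder A] [StarOrderedRing A] (f : State A)

/-- The GNS Hilbert space of a state. -/
abbrev GNS : Type _ := f.toPositive.GNS

/-- The GNS representation of a state. -/
abbrev gnsRep : A →⋆ₐ[ℂ] (f.GNS →L[ℂ] f.GNS) := f.toPositive.gnsStarAlgHom

/-- The cyclic vector of the GNS representation. -/
def gnsVector : f.GNS := ((f.toPositive.toPreGNS 1 : f.toPositive.PreGNS) : f.GNS)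

lemma inner_gnsVector (x : A) :
    inner ℂ f.gnsVector (f.gnsRep x f.gnsVector) = f.toPositive x := by
  change inner ℂ f.gnsVector (f.toPositive.gnsNonUnitalStarAlgHom x _) = _
  rw [gnsVector, PositiveLinearMap.gnsNonUnitalStarAlgHom_apply_coe, Completion.inner_coe,
    PositiveLinearMap.preGNS_inner_def]
  simp

lemma norm_gnsVector : ‖f.gnsVector‖ = 1 := by
  have h := f.inner_gnsVector 1
  rw [map_one, f.map_one', one_apply_eq_self, inner_self_eq_norm_sq_to_K] at h
  have h' : ‖f.gnsVector‖ ^ 2 = 1 := Complex.ofReal_injective (by simpa using h)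
  exact (pow_eq_one_iff_of_nonneg (norm_nonneg _) two_ne_zero).mp h'

lemma norm_apply_le (x : A) : ‖f.toPositive x‖ ≤ ‖x‖ := by
  rw [← f.inner_gnsVector]
  refine (norm_inner_le_norm _ _).trans ?_
  rw [norm_gnsVector, one_mul]
  refine ((f.gnsRep x).le_opNorm _).trans ?_
  rw [norm_gnsVector, mul_one]
  exact NonUnitalStarAlgHom.norm_apply_le f.gnsRep x

end

/-- The vector state `x ↦ ⟪v, π(x) v⟫` of a representation `π` and a unit vector `v`. -/
def ofVector {A : Type*} [CStarAlgebra A] [PartialOrder A] [StarOrderedRing A]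
    {H : Type*} [NormedAddCommGroup H] [InnerProductSpace ℂ H] [CompleteSpace H]
    (π : A →⋆ₐ[ℂ] (H →L[ℂ] H)) (v : H) (hv : ‖v‖ = 1) : State A where
  toPositive := .mk₀
    { toFun := fun x => inner ℂ v (π x v)
      map_add' := fun x y => by simp
      map_smul' := fun c x => by simp }
    (fun x hx => by
      obtain ⟨y, rfl⟩ := CStarAlgebra.nonneg_iff_eq_star_mul_self.mp hx
      change 0 ≤ inner ℂ v (π (star y * y) v)
      rw [map_mul, map_star, mul_apply_eq_comp, ContinuousLinearMap.star_eq_adjoint,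
        ContinuousLinearMap.adjoint_inner_right, inner_self_eq_norm_sq_to_K]
      exact pow_nonneg (Complex.zero_le_real.mpr (norm_nonneg (π y v))) 2)
  map_one' := by
    change inner ℂ v (π 1 v) = 1
    rw [map_one, one_apply_eq_self, inner_self_eq_norm_sq_to_K, hv]
    simp

/-- The pull-back `f ∘ φ` of a state along a unital ⋆-homomorphism. -/
def comp {A B : Type*} [CStarAlgebra A] [PartialOrder A] [StarOrderedRing A]
    [CStarAlgebra B] [PartialOrder B] [StarOrderedRing B] (f : State B) (φ : A →⋆ₐ[ℂ] B) :
    State A where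
  toPositive := .mk₀ (f.toPositive.toLinearMap ∘ₗ (φ : A →ₐ[ℂ] B).toLinearMap) (fun x hx => by
    obtain ⟨y, rfl⟩ := CStarAlgebra.nonneg_iff_eq_star_mul_self.mp hx
    change 0 ≤ f.toPositive (φ (star y * y))
    rw [map_mul, map_star]
    exact f.toPositive.map_nonneg (star_mul_self_nonneg _))
  map_one' := by
    change f.toPositive (φ 1) = 1
    rw [map_one, f.map_one']

lemma comp_apply {A B : Type*} [CStarAlgebra A] [PartialOrder A] [StarOrderedRing A]
    [CStarAlgebra B] [PartialOrder B] [StarOrderedRing B] (f : State B) (φ : A →⋆ₐ[ℂ] B) (x : A) :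
    (f.comp φ).toPositive x = f.toPositive (φ x) := rfl

/-- The extension to the C⋆-completion of a normalized functional on a ⋆-algebra that is
positive and contractive. -/
def extend {A : Type*} [Ring A] [StarRing A] [Algebra ℂ A] [StarModule ℂ A] (p : CStarSeminorm A)
    (f : A →ₗ[ℂ] ℂ) (h1 : f 1 = 1) (hpos : ∀ x, 0 ≤ f (star x * x))
    (hf : ∀ x, ‖f x‖ ≤ p.toSeminorm x) : State p.Compl where
  toPositive := .mk₀ (p.extendL f hf).toLinearMap (fun x hx => by
    obtain ⟨y, rfl⟩ := CStarAlgebra.nonneg_iff_eq_star_mul_self.mp hx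
    refine p.denseRange_toCompl.induction_on (p := fun y => 0 ≤ p.extendL f hf (star y * y)) y
      (isClosed_le (by fun_prop) (by fun_prop)) (fun a => ?_)
    rw [← map_star, ← map_mul, CStarSeminorm.extendL_toCompl]
    exact hpos a)
  map_one' := by
    change p.extendL f hf 1 = 1
    rw [← map_one p.toCompl, CStarSeminorm.extendL_toCompl, h1]

lemma extend_toCompl {A : Type*} [Ring A] [StarRing A] [Algebra ℂ A] [StarModule ℂ A]
    (p : CStarSeminorm A) (f : A →ₗ[ℂ] ℂ) (h1 : f 1 = 1) (hpos : ∀ x, 0 ≤ f (star x * x))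
    (hf : ∀ x, ‖f x‖ ≤ p.toSeminorm x) (x : A) :
    (extend p f h1 hpos hf).toPositive (p.toCompl x) = f x :=
  p.extendL_toCompl f hf x

end State

/-! ### Tensor products -/

/-- The Hilbert space tensor product: the completion of the algebraic tensor product with
`⟪x ⊗ y, x' ⊗ y'⟫ = ⟪x, x'⟫ * ⟪y, y'⟫`. -/
def HilbertTensor (H K : Type*) [NormedAddCommGroup H] [InnerProductSpace ℂ H]
    [NormedAddCommGroup K] [InnerProductSpace ℂ K] : Type _ :=
  Completion (H ⊗[ℂ] K)

section
variable {H K : Type*} [NormedAddCommGroup H] [InnerProductSpace ℂ H]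
    [NormedAddCommGroup K] [InnerProductSpace ℂ K]

instance : NormedAddCommGroup (HilbertTensor H K) :=
  inferInstanceAs (NormedAddCommGroup (Completion (H ⊗[ℂ] K)))
instance : InnerProductSpace ℂ (HilbertTensor H K) :=
  inferInstanceAs (InnerProductSpace ℂ (Completion (H ⊗[ℂ] K)))
instance : CompleteSpace (HilbertTensor H K) :=
  inferInstanceAs (CompleteSpace (Completion (H ⊗[ℂ] K)))

variable (H K) in
/-- The inclusion of the algebraic tensor product. -/
def ofAlg : H ⊗[ℂ] K →ₗᵢ[ℂ] HilbertTensor H K := Completion.toComplₗᵢ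

lemma denseRange_ofAlg : DenseRange (ofAlg H K) :=
  Completion.denseRange_coe (α := H ⊗[ℂ] K)

/-- The elementary tensor of two vectors. -/
def htmul (x : H) (y : K) : HilbertTensor H K := ofAlg H K (x ⊗ₜ y)

lemma inner_htmul (x x' : H) (y y' : K) :
    inner ℂ (htmul x y) (htmul x' y') = inner ℂ x x' * inner ℂ y y' := by
  rw [htmul, htmul, LinearIsometry.inner_map_map, TensorProduct.inner_tmul]

/-- The tensor product `S ⊗ T` of two bounded operators on the Hilbert space tensor product. -/
def opTensor (S : H →L[ℂ] H) (T : K →L[ℂ] K) : HilbertTensor H K →L[ℂ] HilbertTensor H K :=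
  (TensorProduct.mapL S T).completion

lemma opTensor_ofAlg (S : H →L[ℂ] H) (T : K →L[ℂ] K) (x : H ⊗[ℂ] K) :
    opTensor S T (ofAlg H K x) = ofAlg H K (TensorProduct.mapL S T x) :=
  ContinuousLinearMap.completion_apply_coe _ _

lemma opTensor_htmul (S : H →L[ℂ] H) (T : K →L[ℂ] K) (x : H) (y : K) :
    opTensor S T (htmul x y) = htmul (S x) (T y) := by
  rw [htmul, opTensor_ofAlg]; rfl

lemma op_ext {S T : HilbertTensor H K →L[ℂ] HilbertTensor H K}
    (h : ∀ (x : H) (y : K), S (htmul x y) = T (htmul x y)) : S = T := by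
  ext z
  refine denseRange_ofAlg.induction_on (p := fun z => S z = T z) z
    (isClosed_eq S.continuous T.continuous) fun z => ?_
  induction z with
  | zero => rw [map_zero, map_zero, map_zero]
  | add a b ha hb => rw [map_add, map_add, map_add, ha, hb]
  | tmul x y => exact h x y

lemma opTensor_mul (S S' : H →L[ℂ] H) (T T' : K →L[ℂ] K) :
    opTensor (S * S') (T * T') = opTensor S T * opTensor S' T' :=
  op_ext fun x y => by simp [opTensor_htmul]

lemma opTensor_one : opTensor (1 : H →L[ℂ] H) (1 : K →L[ℂ] K) = 1 :=
  op_ext fun x y => by simp [opTensor_htmul]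

lemma norm_opTensor_le (S : H →L[ℂ] H) (T : K →L[ℂ] K) : ‖opTensor S T‖ ≤ ‖S‖ * ‖T‖ := by
  refine ContinuousLinearMap.opNorm_le_bound _ (by positivity) fun z => ?_
  refine denseRange_ofAlg.induction_on (p := fun z => ‖opTensor S T z‖ ≤ ‖S‖ * ‖T‖ * ‖z‖) z
    (isClosed_le (by fun_prop) (by fun_prop)) fun z => ?_
  rw [opTensor_ofAlg, LinearIsometry.norm_map, LinearIsometry.norm_map]
  exact ((TensorProduct.mapL S T).le_opNorm z).trans
    (by gcongr; exact TensorProduct.norm_mapL_le S T)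

lemma star_opTensor [CompleteSpace H] [CompleteSpace K] (S : H →L[ℂ] H) (T : K →L[ℂ] K) :
    star (opTensor S T) = opTensor (star S) (star T) := by
  symm
  rw [ContinuousLinearMap.star_eq_adjoint (opTensor S T), ContinuousLinearMap.eq_adjoint_iff]
  intro x y
  refine denseRange_ofAlg.induction_on₂
    (p := fun x y => inner ℂ (opTensor (star S) (star T) x) y = inner ℂ x (opTensor S T y))
    (isClosed_eq (by fun_prop) (by fun_prop)) (fun x y => ?_) x y
  rw [opTensor_ofAlg, opTensor_ofAlg, LinearIsometry.inner_map_map, LinearIsometry.inner_map_map]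
  induction x with
  | zero => simp
  | add a b ha hb => rw [map_add, inner_add_left, inner_add_left, ha, hb]
  | tmul a b =>
    induction y with
    | zero => simp
    | add c d hc hd => rw [map_add, inner_add_right, inner_add_right, hc, hd]
    | tmul c d =>
      simp [ContinuousLinearMap.star_eq_adjoint, ContinuousLinearMap.adjoint_inner_left]

lemma htmul_add_left (x x' : H) (y : K) : htmul (x + x') y = htmul x y + htmul x' y := by
  simp [htmul, TensorProduct.add_tmul]

lemma htmul_add_right (x : H) (y y' : K) : htmul x (y + y') = htmul x y + htmul x y' := by
  simp [htmul, TensorProduct.tmul_add]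

lemma htmul_smul_left (c : ℂ) (x : H) (y : K) : htmul (c • x) y = c • htmul x y := by
  simp [htmul, ← TensorProduct.smul_tmul']

lemma htmul_smul_right (c : ℂ) (x : H) (y : K) : htmul x (c • y) = c • htmul x y := by
  simp [htmul]

/-- `(S, T) ↦ S ⊗ T` as a bilinear map. -/
def opTensorBilin : (H →L[ℂ] H) →ₗ[ℂ] (K →L[ℂ] K) →ₗ[ℂ]
    (HilbertTensor H K →L[ℂ] HilbertTensor H K) :=
  LinearMap.mk₂ ℂ opTensor
    (fun _ _ _ => op_ext fun _ _ => by simp [opTensor_htmul, htmul_add_left])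
    (fun _ _ _ => op_ext fun _ _ => by simp [opTensor_htmul, htmul_smul_left])
    (fun _ _ _ => op_ext fun _ _ => by simp [opTensor_htmul, htmul_add_right])
    (fun _ _ _ => op_ext fun _ _ => by simp [opTensor_htmul, htmul_smul_right])

end

universe u

section
variable {A B : Type*} [CStarAlgebra A] [CStarAlgebra B]

variable {H K : Type*} [NormedAddCommGroup H] [InnerProductSpace ℂ H] [CompleteSpace H]
    [NormedAddCommGroup K] [InnerProductSpace ℂ K] [CompleteSpace K]
    (π : A →⋆ₐ[ℂ] (H →L[ℂ] H)) (ρ : B →⋆ₐ[ℂ] (K →L[ℂ] K))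

/-- The linear map underlying `algRepTensor`. -/
def algRepTensorL : A ⊗[ℂ] B →ₗ[ℂ] (HilbertTensor H K →L[ℂ] HilbertTensor H K) :=
  TensorProduct.lift (opTensorBilin.compl₁₂ (π : A →ₐ[ℂ] (H →L[ℂ] H)).toLinearMap
    (ρ : B →ₐ[ℂ] (K →L[ℂ] K)).toLinearMap)

lemma algRepTensorL_tmul (a : A) (b : B) :
    algRepTensorL π ρ (a ⊗ₜ b) = opTensor (π a) (ρ b) := rfl

/-- The representation `a ⊗ b ↦ π(a) ⊗ ρ(b)` of the algebraic tensor product. -/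
def algRepTensor : A ⊗[ℂ] B →⋆ₐ[ℂ] (HilbertTensor H K →L[ℂ] HilbertTensor H K) :=
  { Algebra.TensorProduct.algHomOfLinearMapTensorProduct (algRepTensorL π ρ)
      (fun a₁ a₂ b₁ b₂ => by
        rw [algRepTensorL_tmul, algRepTensorL_tmul, algRepTensorL_tmul, map_mul, map_mul,
          opTensor_mul])
      (by rw [algRepTensorL_tmul, map_one, map_one, opTensor_one]) with
    map_star' := fun x => by
      change algRepTensorL π ρ (star x) = star (algRepTensorL π ρ x)
      induction x with
      | zero => rw [star_zero, map_zero, star_zero]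
      | add x y hx hy => rw [star_add, map_add, map_add, star_add, hx, hy]
      | tmul a b =>
        rw [TensorProduct.star_tmul, algRepTensorL_tmul, algRepTensorL_tmul, star_opTensor,
          map_star, map_star] }

lemma algRepTensor_tmul (a : A) (b : B) :
    algRepTensor π ρ (a ⊗ₜ b) = opTensor (π a) (ρ b) := rfl

end

section
variable (A B : Type u) [CStarAlgebra A] [CStarAlgebra B]

variable {A B} in
/-- The norms of `(π ⊗ ρ)(x)`, where `π` and `ρ` run over all representations of `A` and `B`
on Hilbert spaces. -/
def repNorms (x : A ⊗[ℂ] B) : Set ℝ :=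
  {r | ∃ (H : Type u) (_ : NormedAddCommGroup H) (_ : InnerProductSpace ℂ H) (_ : CompleteSpace H)
    (K : Type u) (_ : NormedAddCommGroup K) (_ : InnerProductSpace ℂ K) (_ : CompleteSpace K)
    (π : A →⋆ₐ[ℂ] (H →L[ℂ] H)) (ρ : B →⋆ₐ[ℂ] (K →L[ℂ] K)), r = ‖algRepTensor π ρ x‖}

variable {A B}

lemma bddAbove_repNorms (x : A ⊗[ℂ] B) : BddAbove (repNorms x) := by
  induction x with
  | zero => exact ⟨0, by rintro r ⟨H, _, _, _, K, _, _, _, π, ρ, rfl⟩; simp⟩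
  | add x y hx hy =>
    obtain ⟨c, hc⟩ := hx
    obtain ⟨d, hd⟩ := hy
    refine ⟨c + d, ?_⟩
    rintro r ⟨H, _, _, _, K, _, _, _, π, ρ, rfl⟩
    rw [map_add]
    exact (norm_add_le _ _).trans (add_le_add (hc ⟨H, _, _, _, K, _, _, _, π, ρ, rfl⟩)
      (hd ⟨H, _, _, _, K, _, _, _, π, ρ, rfl⟩))
  | tmul a b =>
    refine ⟨‖a‖ * ‖b‖, ?_⟩
    rintro r ⟨H, _, _, _, K, _, _, _, π, ρ, rfl⟩
    rw [algRepTensor_tmul]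
    refine (norm_opTensor_le _ _).trans ?_
    gcongr
    · exact NonUnitalStarAlgHom.norm_apply_le π a
    · exact NonUnitalStarAlgHom.norm_apply_le ρ b

lemma norm_algRepTensor_le {H K : Type u}
    [NormedAddCommGroup H] [InnerProductSpace ℂ H] [CompleteSpace H]
    [NormedAddCommGroup K] [InnerProductSpace ℂ K] [CompleteSpace K]
    (π : A →⋆ₐ[ℂ] (H →L[ℂ] H)) (ρ : B →⋆ₐ[ℂ] (K →L[ℂ] K)) (x : A ⊗[ℂ] B) :
    ‖algRepTensor π ρ x‖ ≤ sSup (repNorms x) :=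
  le_csSup (bddAbove_repNorms x) ⟨H, _, _, _, K, _, _, _, π, ρ, rfl⟩

lemma sSup_repNorms_nonneg (x : A ⊗[ℂ] B) : 0 ≤ sSup (repNorms x) := by
  refine Real.sSup_nonneg ?_
  rintro r ⟨H, _, _, _, K, _, _, _, π, ρ, rfl⟩
  exact norm_nonneg _

lemma sSup_repNorms_le {x : A ⊗[ℂ] B} {c : ℝ} (hc : 0 ≤ c)
    (h : ∀ (H : Type u) [NormedAddCommGroup H] [InnerProductSpace ℂ H] [CompleteSpace H]
      (K : Type u) [NormedAddCommGroup K] [InnerProductSpace ℂ K] [CompleteSpace K]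
      (π : A →⋆ₐ[ℂ] (H →L[ℂ] H)) (ρ : B →⋆ₐ[ℂ] (K →L[ℂ] K)), ‖algRepTensor π ρ x‖ ≤ c) :
    sSup (repNorms x) ≤ c := by
  refine Real.sSup_le ?_ hc
  rintro r ⟨H, _, _, _, K, _, _, _, π, ρ, rfl⟩
  exact h H K π ρ

variable (A B) in
/-- The minimal (spatial) C⋆-norm on the algebraic tensor product: the supremum of
`‖(π ⊗ ρ)(x)‖` over all representations `π` of `A` and `ρ` of `B`. -/
def minNorm : CStarSeminorm (A ⊗[ℂ] B) where
  toSeminorm := Seminorm.ofSMulLE (fun x => sSup (repNorms x))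
    (le_antisymm (sSup_repNorms_le le_rfl fun H _ _ _ K _ _ _ π ρ => by simp)
      (sSup_repNorms_nonneg _))
    (fun x y => sSup_repNorms_le
      (add_nonneg (sSup_repNorms_nonneg _) (sSup_repNorms_nonneg _))
      fun H _ _ _ K _ _ _ π ρ => by
        rw [map_add]
        exact (norm_add_le _ _).trans
          (add_le_add (norm_algRepTensor_le π ρ x) (norm_algRepTensor_le π ρ y)))
    (fun c x => sSup_repNorms_le (mul_nonneg (norm_nonneg _) (sSup_repNorms_nonneg _))
      fun H _ _ _ K _ _ _ π ρ => by
        rw [map_smul, norm_smul]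
        exact mul_le_mul_of_nonneg_left (norm_algRepTensor_le π ρ x) (norm_nonneg _))
  mul_le' x y := sSup_repNorms_le
    (mul_nonneg (sSup_repNorms_nonneg _) (sSup_repNorms_nonneg _))
    fun H _ _ _ K _ _ _ π ρ => by
      rw [map_mul]
      exact (norm_mul_le _ _).trans (mul_le_mul (norm_algRepTensor_le π ρ x)
        (norm_algRepTensor_le π ρ y) (norm_nonneg _) (sSup_repNorms_nonneg _))
  le_star_mul_self' x := by
    change sSup (repNorms x) * sSup (repNorms x) ≤ sSup (repNorms (star x * x))
    have h : sSup (repNorms x) ≤ Real.sqrt (sSup (repNorms (star x * x))) := by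
      refine sSup_repNorms_le (Real.sqrt_nonneg _) fun H _ _ _ K _ _ _ π ρ => ?_
      refine Real.le_sqrt_of_sq_le ?_
      rw [sq, ← CStarRing.norm_star_mul_self, ← map_star, ← map_mul]
      exact norm_algRepTensor_le π ρ _
    calc _ ≤ Real.sqrt (sSup (repNorms (star x * x))) * Real.sqrt (sSup (repNorms (star x * x))) :=
          mul_self_le_mul_self (sSup_repNorms_nonneg _) h
      _ = _ := Real.mul_self_sqrt (sSup_repNorms_nonneg _)

variable (A B) in
/-- The minimal C⋆-tensor product of two unital C⋆-algebras. -/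
abbrev MinTensor : Type u := (minNorm A B).Compl

/-- The elementary tensor `a ⊗ b` in the minimal tensor product. -/
def minTmul (a : A) (b : B) : MinTensor A B := (minNorm A B).toCompl (a ⊗ₜ b)

lemma norm_minTmul_le (a : A) (b : B) : ‖minTmul a b‖ ≤ ‖a‖ * ‖b‖ := by
  rw [minTmul, CStarSeminorm.norm_toCompl]
  refine sSup_repNorms_le (by positivity) fun H _ _ _ K _ _ _ π ρ => ?_
  rw [algRepTensor_tmul]
  exact (norm_opTensor_le _ _).trans (mul_le_mul (NonUnitalStarAlgHom.norm_apply_le π a)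
    (NonUnitalStarAlgHom.norm_apply_le ρ b) (norm_nonneg _) (norm_nonneg _))

lemma continuous_minTmul : Continuous fun z : A × B => minTmul z.1 z.2 := by
  let L : A →ₗ[ℂ] B →ₗ[ℂ] MinTensor A B :=
    (TensorProduct.mk ℂ A B).compr₂ (minNorm A B).toCompl.toAlgHom.toLinearMap
  exact (L.mkContinuous₂ 1 fun a b => by
    rw [one_mul]; exact norm_minTmul_le a b).continuous₂

/-- The tensor product `π ⊗ ρ` of two representations, as a representation of the minimal tensor
product on the Hilbert space tensor product. -/
def repTensor {H K : Type u} [NormedAddCommGroup H] [InnerProductSpace ℂ H] [CompleteSpace H]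
    [NormedAddCommGroup K] [InnerProductSpace ℂ K] [CompleteSpace K]
    (π : A →⋆ₐ[ℂ] (H →L[ℂ] H)) (ρ : B →⋆ₐ[ℂ] (K →L[ℂ] K)) :
    MinTensor A B →⋆ₐ[ℂ] (HilbertTensor H K →L[ℂ] HilbertTensor H K) :=
  (minNorm A B).extend (algRepTensor π ρ) (norm_algRepTensor_le π ρ)

lemma repTensor_minTmul {H K : Type u}
    [NormedAddCommGroup H] [InnerProductSpace ℂ H] [CompleteSpace H]
    [NormedAddCommGroup K] [InnerProductSpace ℂ K] [CompleteSpace K]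
    (π : A →⋆ₐ[ℂ] (H →L[ℂ] H)) (ρ : B →⋆ₐ[ℂ] (K →L[ℂ] K)) (a : A) (b : B) :
    repTensor π ρ (minTmul a b) = opTensor (π a) (ρ b) := by
  exact (minNorm A B).extend_toCompl (algRepTensor π ρ) _ (a ⊗ₜ b)

variable [PartialOrder A] [StarOrderedRing A] [PartialOrder B] [StarOrderedRing B]

/-- The tensor product `f ⊗ g` of two states: the state of the minimal tensor product
with `(f ⊗ g)(a ⊗ b) = f(a) g(b)`, obtained as a vector state of the tensor product of the
GNS representations. -/
def stateTensor (f : State A) (g : State B) : State (MinTensor A B) :=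
  .ofVector (repTensor f.gnsRep g.gnsRep)
    (htmul f.gnsVector g.gnsVector)
    (by rw [htmul, LinearIsometry.norm_map, TensorProduct.norm_tmul, f.norm_gnsVector,
      g.norm_gnsVector, mul_one])

lemma stateTensor_minTmul (f : State A) (g : State B) (a : A) (b : B) :
    (stateTensor f g).toPositive (minTmul a b) = f.toPositive a * g.toPositive b := by
  change inner ℂ _ (repTensor f.gnsRep g.gnsRep (minTmul a b) _) = _
  rw [repTensor_minTmul, opTensor_htmul, inner_htmul,
    f.inner_gnsVector, g.inner_gnsVector]

end

/-- Unitary equivalence of representations on Hilbert spaces. -/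
def UnitarilyEquivalent {A : Type*} [CStarAlgebra A]
    {H K : Type*} [NormedAddCommGroup H] [InnerProductSpace ℂ H] [CompleteSpace H]
    [NormedAddCommGroup K] [InnerProductSpace ℂ K] [CompleteSpace K]
    (π : A →⋆ₐ[ℂ] (H →L[ℂ] H)) (ρ : A →⋆ₐ[ℂ] (K →L[ℂ] K)) : Prop :=
  ∃ U : H ≃ₗᵢ[ℂ] K, ∀ (x : A) (ξ : H), U (π x ξ) = ρ x (U ξ)

/-! ### UHF algebras -/

section UHFAlgebras
open scoped Kronecker Matrix.Norms.L2Operator MatrixOrder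

/-- Sequences of integers `≥ 2` (indexed from `0`). -/
abbrev Seq2 : Type := {a : ℕ → ℕ // ∀ n, 2 ≤ a n}

/-- The componentwise product of sequences. -/
instance : Mul Seq2 :=
  ⟨fun a b => ⟨fun n => a.1 n * b.1 n, fun n => (Nat.le_mul_of_pos_right 2
    (two_pos.trans_le (b.2 n))).trans (Nat.mul_le_mul_right _ (a.2 n))⟩⟩

variable (a b : Seq2)

instance (n : ℕ) : NeZero (a.1 n) := ⟨(two_pos.trans_le (a.2 n)).ne'⟩

/-- Multi-indices of length `n`, the index set of the matrix units `E_{J,K}` of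
`M_{a 0} ⊗ ⋯ ⊗ M_{a (n-1)}`. -/
abbrev Idx (n : ℕ) : Type := (i : Fin n) → Fin (a.1 i)

/-- `M_{a 0} ⊗ ⋯ ⊗ M_{a (n-1)}`, as the algebra of matrices indexed by multi-indices. -/
abbrev Mat (n : ℕ) : Type := Matrix (Idx a n) (Idx a n) ℂ

/-- Splitting off the last component of a multi-index. -/
def splitLast (n : ℕ) : Idx a (n + 1) ≃ Idx a n × Fin (a.1 n) :=
  (Fin.snocEquiv (fun i : Fin (n + 1) => Fin (a.1 i))).symm.trans (Equiv.prodComm _ _)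

lemma splitLast_apply (n : ℕ) (x : Idx a (n + 1)) :
    splitLast a n x = (fun i : Fin n => x (Fin.castSucc i), x (Fin.last n)) := rfl

/-- The embedding `x ↦ x ⊗ 1` of `Mat a n` into `Mat a (n + 1)`. -/
def psi (n : ℕ) : Mat a n →⋆ₐ[ℂ] Mat a (n + 1) where
  toFun x := (x ⊗ₖ (1 : Matrix (Fin (a.1 n)) (Fin (a.1 n)) ℂ)).submatrix
    (splitLast a n) (splitLast a n)
  map_one' := by simp
  map_mul' x y := by
    rw [Matrix.submatrix_mul_equiv, ← Matrix.mul_kronecker_mul, one_mul]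
  map_zero' := by simp
  map_add' x y := by simp [Matrix.add_kronecker, Matrix.submatrix_add]
  commutes' c := by
    simp [Algebra.algebraMap_eq_smul_one, Matrix.smul_kronecker, Matrix.submatrix_smul]
  map_star' x := by
    simp [Matrix.star_eq_conjTranspose, Matrix.conjTranspose_kronecker]

lemma psi_apply (n : ℕ) (x : Mat a n) : psi a n x =
    (x ⊗ₖ (1 : Matrix (Fin (a.1 n)) (Fin (a.1 n)) ℂ)).submatrix
      (splitLast a n) (splitLast a n) := rfl

lemma psi_injective (n : ℕ) : Function.Injective (psi a n) := by
  intro x y h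
  ext i j
  have := congrFun (congrFun h ((splitLast a n).symm (i, 0))) ((splitLast a n).symm (j, 0))
  simpa [psi_apply] using this

/-- The composite embedding of `Mat a m` into `Mat a n` for `m ≤ n`. -/
def psiLE (m n : ℕ) (h : m ≤ n) : Mat a m →⋆ₐ[ℂ] Mat a n :=
  Nat.leRecOn (C := fun k => Mat a m →⋆ₐ[ℂ] Mat a k) h (fun {k} f => (psi a k).comp f)
    (StarAlgHom.id ℂ (Mat a m))

lemma psiLE_self (n : ℕ) (x : Mat a n) : psiLE a n n le_rfl x = x := by
  rw [psiLE, Nat.leRecOn_self]; rfl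

lemma psiLE_succ {m n : ℕ} (h : m ≤ n) (x : Mat a m) :
    psiLE a m (n + 1) (h.trans n.le_succ) x = psi a n (psiLE a m n h x) := by
  rw [psiLE, Nat.leRecOn_succ h]; rfl

instance : DirectedSystem (Mat a) (fun m n h => ⇑(psiLE a m n h)) where
  map_self n x := psiLE_self a n x
  map_map {m n k} hmn hnk x := by
    induction hnk with
    | refl => rw [psiLE_self]
    | step h ih => rw [psiLE_succ a h, psiLE_succ a (hmn.trans h), ih]

lemma psiLE_injective {m n : ℕ} (h : m ≤ n) : Function.Injective (psiLE a m n h) := by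
  induction h with
  | refl => intro x y h; simpa [psiLE_self] using h
  | step h ih =>
    intro x y hxy
    rw [psiLE_succ a h, psiLE_succ a h] at hxy
    exact ih (psi_injective a _ hxy)

/-- The algebraic inductive limit of the matrix algebras `Mat a n`. -/
abbrev AlgLim : Type := DirectLimit (Mat a) (psiLE a)

/-- The canonical embedding of `Mat a n` into the algebraic inductive limit. -/
def toAlgLim (n : ℕ) : Mat a n →⋆ₐ[ℂ] AlgLim a :=
  { DirectLimit.Algebra.of (Mat a) (psiLE a) n with map_star' := fun _ => rfl }

lemma toAlgLim_psi (n : ℕ) (x : Mat a n) : toAlgLim a (n + 1) (psi a n x) = toAlgLim a n x := by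
  have h := DirectLimit.Algebra.of_f (R := ℂ) (G := Mat a) (f := psiLE a) n.le_succ x
  have h' := psiLE_succ a (le_refl n) x
  rw [psiLE_self] at h'
  rw [← h']
  exact h

lemma exists_toAlgLim (x : AlgLim a) : ∃ n y, x = toAlgLim a n y :=
  DirectLimit.exists_eq_mk (psiLE a) x

lemma exists_toAlgLim₂ (x y : AlgLim a) :
    ∃ n x' y', x = toAlgLim a n x' ∧ y = toAlgLim a n y' :=
  DirectLimit.exists_eq_mk₂ (psiLE a) x y

lemma psiLE_compat {X : Type*} (g : ∀ n, Mat a n → X) (hg : ∀ n x, g (n + 1) (psi a n x) = g n x)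
    (m n : ℕ) (h : m ≤ n) (x : Mat a m) : g n (psiLE a m n h x) = g m x := by
  induction h with
  | refl => rw [psiLE_self]
  | step h ih => rw [psiLE_succ a h, hg, ih]

/-- The norm of the inductive limit, which restricts to the operator norm on each `Mat a n`. -/
def limNorm (x : AlgLim a) : ℝ :=
  DirectLimit.lift (psiLE a · · ·) (fun _ (x : Mat a _) => ‖x‖)
    (fun m n h x => (NonUnitalStarAlgHom.norm_map (psiLE a m n h) (psiLE_injective a h) x).symm) x

lemma limNorm_toAlgLim (n : ℕ) (x : Mat a n) : limNorm a (toAlgLim a n x) = ‖x‖ := rfl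

/-- The C⋆-norm on the algebraic inductive limit. -/
def limCStarNorm : CStarSeminorm (AlgLim a) where
  toSeminorm := Seminorm.ofSMulLE (limNorm a)
    (by rw [← map_zero (toAlgLim a 0), limNorm_toAlgLim, norm_zero])
    (fun x y => by
      obtain ⟨n, x, y, rfl, rfl⟩ := exists_toAlgLim₂ a x y
      rw [← map_add, limNorm_toAlgLim, limNorm_toAlgLim, limNorm_toAlgLim]
      exact norm_add_le x y)
    (fun c x => by
      obtain ⟨n, x, rfl⟩ := exists_toAlgLim a x
      rw [← map_smul, limNorm_toAlgLim, limNorm_toAlgLim]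
      exact norm_smul_le c x)
  mul_le' x y := by
    change limNorm a (x * y) ≤ limNorm a x * limNorm a y
    obtain ⟨n, x, y, rfl, rfl⟩ := exists_toAlgLim₂ a x y
    rw [← map_mul, limNorm_toAlgLim, limNorm_toAlgLim, limNorm_toAlgLim]
    exact norm_mul_le x y
  le_star_mul_self' x := by
    change limNorm a x * limNorm a x ≤ limNorm a (star x * x)
    obtain ⟨n, x, rfl⟩ := exists_toAlgLim a x
    rw [← map_star, ← map_mul, limNorm_toAlgLim, limNorm_toAlgLim]
    exact CStarRing.norm_mul_self_le x

lemma limCStarNorm_toAlgLim (n : ℕ) (x : Mat a n) :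
    (limCStarNorm a).toSeminorm (toAlgLim a n x) = ‖x‖ := rfl

/-- The UHF algebra of the sequence `a`: the C⋆-inductive limit of the matrix algebras
`M_{a 0} ⊗ ⋯ ⊗ M_{a (n-1)}` under the embeddings `x ↦ x ⊗ 1`. -/
abbrev UHFAlg : Type := (limCStarNorm a).Compl

/-- The canonical embedding of `Mat a n` into the UHF algebra. -/
def toUHF (n : ℕ) : Mat a n →⋆ₐ[ℂ] UHFAlg a := (limCStarNorm a).toCompl.comp (toAlgLim a n)

lemma toUHF_psi (n : ℕ) (x : Mat a n) : toUHF a (n + 1) (psi a n x) = toUHF a n x := by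
  rw [toUHF, StarAlgHom.comp_apply, toAlgLim_psi]; rfl

variable {a} in
/-- The ⋆-homomorphism on the UHF algebra induced by a compatible family on the `Mat a n`. -/
def liftUHF {B : Type*} [CStarAlgebra B] (g : ∀ n, Mat a n →⋆ₐ[ℂ] B)
    (hg : ∀ n x, g (n + 1) (psi a n x) = g n x) : UHFAlg a →⋆ₐ[ℂ] B :=
  (limCStarNorm a).extend
    { DirectLimit.Algebra.lift (R := ℂ) (Mat a) (psiLE a) B
        (fun n => (g n : Mat a n →ₐ[ℂ] B)) (psiLE_compat a (fun n => ⇑(g n)) hg) with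
      map_star' := fun x => by
        obtain ⟨n, x, rfl⟩ := exists_toAlgLim a x
        exact map_star (g n) x }
    (fun x => by
      obtain ⟨n, x, rfl⟩ := exists_toAlgLim a x
      exact NonUnitalStarAlgHom.norm_apply_le (g n) x)

variable {a} in
lemma liftUHF_toUHF {B : Type*} [CStarAlgebra B] (g : ∀ n, Mat a n →⋆ₐ[ℂ] B)
    (hg : ∀ n x, g (n + 1) (psi a n x) = g n x) (n : ℕ) (x : Mat a n) :
    liftUHF g hg (toUHF a n x) = g n x :=
  (limCStarNorm a).extend_toCompl _ _ (toAlgLim a n x)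

variable {a} in
lemma norm_liftUHF {B : Type*} [CStarAlgebra B] [Nontrivial B] (g : ∀ n, Mat a n →⋆ₐ[ℂ] B)
    (hg : ∀ n x, g (n + 1) (psi a n x) = g n x) (x : UHFAlg a) : ‖liftUHF g hg x‖ = ‖x‖ := by
  have hc : Continuous (liftUHF g hg) := AddMonoidHomClass.continuous_of_bound _ 1 fun x => by
    simpa using NonUnitalStarAlgHom.norm_apply_le (liftUHF g hg) x
  refine (limCStarNorm a).denseRange_toCompl.induction_on
    (p := fun x => ‖liftUHF g hg x‖ = ‖x‖) x (isClosed_eq hc.norm continuous_norm) fun x => ?_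
  obtain ⟨n, x, rfl⟩ := exists_toAlgLim _ x
  change ‖liftUHF g hg (toUHF a n x)‖ = _
  rw [liftUHF_toUHF, NonUnitalStarAlgHom.norm_map (g n)
    (RingHom.injective (g n : Mat a n →+* B)), CStarSeminorm.norm_toCompl, limCStarNorm_toAlgLim]

lemma toUHF_psiLE (m n : ℕ) (h : m ≤ n) (x : Mat a m) :
    toUHF a n (psiLE a m n h x) = toUHF a m x :=
  psiLE_compat a (fun n x => toUHF a n x) (toUHF_psi a) m n h x

/-! ### The isomorphisms `φ_{a,b}` -/

/-- The bijection `j = b * j' + j'' ↔ (j', j'')` (indices starting from `0`). -/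
def finSplit (n : ℕ) : Fin ((a * b).1 n) ≃ Fin (a.1 n) × Fin (b.1 n) :=
  (finProdFinEquiv (m := a.1 n) (n := b.1 n)).symm

/-- The componentwise bijection `J ↔ (J', J'')`. -/
def idxSplit (n : ℕ) : Idx (a * b) n ≃ Idx a n × Idx b n where
  toFun j := (fun i => (finSplit a b i (j i)).1, fun i => (finSplit a b i (j i)).2)
  invFun j := fun i => (finSplit a b i).symm (j.1 i, j.2 i)
  left_inv j := by ext i; simp
  right_inv j := by ext i <;> simp

/-- Renaming the indices of matrices. -/
def reindexStar {m n : Type*} [Fintype m] [DecidableEq m] [Fintype n] [DecidableEq n]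
    (e : m ≃ n) : Matrix m m ℂ ≃⋆ₐ[ℂ] Matrix n n ℂ :=
  .ofAlgEquiv (Matrix.reindexAlgEquiv ℂ ℂ e) fun x => by
    simp [Matrix.star_eq_conjTranspose]

/-- The Kronecker product as an isomorphism of `Mat a n ⊗ Mat b n` with `Mat (a * b) n`. -/
def kronLevel (n : ℕ) : Mat a n ⊗[ℂ] Mat b n ≃⋆ₐ[ℂ] Mat (a * b) n :=
  (Matrix.kroneckerStarAlgEquiv (Idx a n) (Idx b n) ℂ).trans (reindexStar (idxSplit a b n).symm)

lemma kronLevel_tmul (n : ℕ) (x : Mat a n) (y : Mat b n) :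
    kronLevel a b n (x ⊗ₜ y) = (x ⊗ₖ y).submatrix (idxSplit a b n) (idxSplit a b n) := by
  have h : Matrix.kroneckerStarAlgEquiv (Idx a n) (Idx b n) ℂ (x ⊗ₜ y) = x ⊗ₖ y := by simp
  change reindexStar _ (Matrix.kroneckerStarAlgEquiv (Idx a n) (Idx b n) ℂ (x ⊗ₜ y)) = _
  rw [h]
  rfl

lemma psi_kronLevel (n : ℕ) (x : Mat a n) (y : Mat b n) :
    psi (a * b) n (kronLevel a b n (x ⊗ₜ y)) = kronLevel a b (n + 1) (psi a n x ⊗ₜ psi b n y) := by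
  rw [kronLevel_tmul, kronLevel_tmul]
  ext i j
  have h : (1 : Matrix (Fin ((a * b).1 n)) (Fin ((a * b).1 n)) ℂ) (i (Fin.last n)) (j (Fin.last n))
      = (1 : Matrix (Fin (a.1 n)) (Fin (a.1 n)) ℂ) (finSplit a b n (i (Fin.last n))).1
          (finSplit a b n (j (Fin.last n))).1
        * (1 : Matrix (Fin (b.1 n)) (Fin (b.1 n)) ℂ) (finSplit a b n (i (Fin.last n))).2
          (finSplit a b n (j (Fin.last n))).2 := by
    simp only [Matrix.one_apply, ← (finSplit a b n).injective.eq_iff, Prod.ext_iff, ite_and,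
      mul_ite, mul_one, mul_zero]
    split_ifs <;> rfl
  simp only [psi_apply, Matrix.submatrix_apply, Matrix.kroneckerMap_apply, splitLast_apply]
  rw [h]
  exact mul_mul_mul_comm _ _ _ _

/-- The tensor product of two ⋆-homomorphisms. -/
def mapTensor {A B C D : Type*} [Ring A] [StarRing A] [Algebra ℂ A] [StarModule ℂ A]
    [Ring B] [StarRing B] [Algebra ℂ B] [StarModule ℂ B]
    [Ring C] [StarRing C] [Algebra ℂ C] [StarModule ℂ C]
    [Ring D] [StarRing D] [Algebra ℂ D] [StarModule ℂ D]
    (f : A →⋆ₐ[ℂ] C) (g : B →⋆ₐ[ℂ] D) : A ⊗[ℂ] B →⋆ₐ[ℂ] C ⊗[ℂ] D :=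
  { Algebra.TensorProduct.map (f : A →ₐ[ℂ] C) (g : B →ₐ[ℂ] D) with
    map_star' := fun x => by
      change Algebra.TensorProduct.map (f : A →ₐ[ℂ] C) (g : B →ₐ[ℂ] D) (star x) =
        star (Algebra.TensorProduct.map (f : A →ₐ[ℂ] C) (g : B →ₐ[ℂ] D) x)
      induction x with
      | zero => simp
      | add x y hx hy => rw [star_add, map_add, map_add, star_add, hx, hy]
      | tmul x y => simp [map_star] }

/-- The map `φ_{a,b}^{(n)}`, followed by the inclusion into `UHFAlg a ⊗ UHFAlg b`. -/
def phiLevel (n : ℕ) : Mat (a * b) n →⋆ₐ[ℂ] MinTensor (UHFAlg a) (UHFAlg b) :=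
  ((minNorm (UHFAlg a) (UHFAlg b)).toCompl.comp (mapTensor (toUHF a n) (toUHF b n))).comp
    (kronLevel a b n).symm

lemma phiLevel_kronLevel (n : ℕ) (x : Mat a n) (y : Mat b n) :
    phiLevel a b n (kronLevel a b n (x ⊗ₜ y)) = minTmul (toUHF a n x) (toUHF b n y) := by
  have h : (kronLevel a b n).symm (kronLevel a b n (x ⊗ₜ y)) = x ⊗ₜ y :=
    StarAlgEquiv.symm_apply_apply _ _
  change (minNorm (UHFAlg a) (UHFAlg b)).toCompl (mapTensor (toUHF a n) (toUHF b n)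
    ((kronLevel a b n).symm (kronLevel a b n (x ⊗ₜ y)))) = _
  rw [h]
  rfl

variable {a b} in
lemma eq_of_kronLevel {E : Type*} [AddCommMonoid E] {n : ℕ} (f g : Mat (a * b) n →+ E)
    (h : ∀ x y, f (kronLevel a b n (x ⊗ₜ y)) = g (kronLevel a b n (x ⊗ₜ y))) (x : Mat (a * b) n) :
    f x = g x := by
  obtain ⟨z, rfl⟩ := (kronLevel a b n).surjective x
  induction z with
  | zero => rw [map_zero, map_zero, map_zero]
  | add x y hx hy => rw [map_add, map_add, map_add, hx, hy]
  | tmul x y => exact h x y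

lemma phiLevel_psi (n : ℕ) (x : Mat (a * b) n) :
    phiLevel a b (n + 1) (psi (a * b) n x) = phiLevel a b n x := by
  refine eq_of_kronLevel
    (AddMonoidHomClass.toAddMonoidHom ((phiLevel a b (n + 1)).comp (psi (a * b) n)))
    (AddMonoidHomClass.toAddMonoidHom (phiLevel a b n)) (fun x y => ?_) x
  change phiLevel a b (n + 1) (psi (a * b) n _) = phiLevel a b n _
  rw [psi_kronLevel, phiLevel_kronLevel, phiLevel_kronLevel, toUHF_psi, toUHF_psi]

lemma single_eq_kronLevel (n : ℕ) (j k : Idx (a * b) n) :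
    Matrix.single j k (1 : ℂ) = kronLevel a b n
      (Matrix.single (idxSplit a b n j).1 (idxSplit a b n k).1 1 ⊗ₜ
        Matrix.single (idxSplit a b n j).2 (idxSplit a b n k).2 1) := by
  rw [kronLevel_tmul]
  ext p q
  simp only [Matrix.single_apply, Matrix.submatrix_apply, Matrix.kroneckerMap_apply,
    ← (idxSplit a b n).injective.eq_iff, Prod.ext_iff, mul_ite, mul_one, mul_zero]
  split_ifs <;> simp_all

/-- The ⋆-homomorphism `φ_{a,b}` from `UHFAlg (a * b)` to `UHFAlg a ⊗ UHFAlg b`. -/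
def phiHom : UHFAlg (a * b) →⋆ₐ[ℂ] MinTensor (UHFAlg a) (UHFAlg b) :=
  liftUHF (phiLevel a b) (phiLevel_psi a b)

lemma phiHom_kronLevel (n : ℕ) (x : Mat a n) (y : Mat b n) :
    phiHom a b (toUHF (a * b) n (kronLevel a b n (x ⊗ₜ y)))
      = minTmul (toUHF a n x) (toUHF b n y) := by
  rw [phiHom, liftUHF_toUHF, phiLevel_kronLevel]

/-! ### Product states -/

/-- Density matrices: positive matrices of trace one. -/
abbrev Density (n : ℕ) : Type := {T : Matrix (Fin n) (Fin n) ℂ // T.PosSemidef ∧ T.trace = 1}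

/-- Sequences of density matrices `T n ∈ M_{a n}`. -/
abbrev DensitySeq (a : Seq2) : Type := (n : ℕ) → Density (a.1 n)

variable {a b} (T : DensitySeq a) (R : DensitySeq b)

/-- The density matrix `T 0 ⊗ ⋯ ⊗ T (n-1)`. -/
def tensorDensity (n : ℕ) : Mat a n := .of fun j k => ∏ i : Fin n, (T i).1 (j i) (k i)

lemma tensorDensity_succ (n : ℕ) : tensorDensity T (n + 1) =
    (tensorDensity T n ⊗ₖ (T n).1).submatrix (splitLast a n) (splitLast a n) := by
  ext j k
  exact Fin.prod_univ_castSucc _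

lemma trace_submatrix_equiv {m n : Type*} [Fintype m] [Fintype n] (e : m ≃ n)
    (x : Matrix n n ℂ) : (x.submatrix e e).trace = x.trace :=
  e.sum_comp fun i => x i i

lemma tensorDensity_mem (n : ℕ) :
    (tensorDensity T n).PosSemidef ∧ (tensorDensity T n).trace = 1 := by
  induction n with
  | zero =>
    have h : tensorDensity T 0 = 1 := by
      ext j k
      rw [Subsingleton.elim j k, Matrix.one_apply_eq]
      simp [tensorDensity]
    rw [h]
    exact ⟨Matrix.PosSemidef.one, by simp⟩
  | succ n ih =>
    rw [tensorDensity_succ, trace_submatrix_equiv, Matrix.trace_kronecker, ih.2, (T n).2.2, one_mul]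
    exact ⟨(ih.1.kronecker (T n).2.1).submatrix _, rfl⟩

/-- The state `x ↦ tr ((T 0 ⊗ ⋯ ⊗ T (n-1)) x)` of `Mat a n`. -/
def levelState (n : ℕ) : State (Mat a n) where
  toPositive := .mk₀ (Matrix.traceLinearMap (Idx a n) ℂ ℂ ∘ₗ
      LinearMap.mulLeft ℂ (tensorDensity T n)) (fun x hx => by
    obtain ⟨y, rfl⟩ := CStarAlgebra.nonneg_iff_eq_star_mul_self.mp hx
    change 0 ≤ (tensorDensity T n * (star y * y)).trace
    rw [← mul_assoc, Matrix.trace_mul_comm, ← mul_assoc]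
    exact ((tensorDensity_mem T n).1.mul_mul_conjTranspose_same y).trace_nonneg)
  map_one' := by
    change (tensorDensity T n * 1).trace = 1
    rw [mul_one, (tensorDensity_mem T n).2]

lemma levelState_apply (n : ℕ) (x : Mat a n) :
    (levelState T n).toPositive x = (tensorDensity T n * x).trace := rfl

lemma levelState_psi (n : ℕ) (x : Mat a n) :
    (levelState T (n + 1)).toPositive (psi a n x) = (levelState T n).toPositive x := by
  rw [levelState_apply, levelState_apply, psi_apply, tensorDensity_succ,
    Matrix.submatrix_mul_equiv, trace_submatrix_equiv, ← Matrix.mul_kronecker_mul,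
    Matrix.trace_kronecker, mul_one, (T n).2.2, mul_one]

/-- The product state `ω_T` of the UHF algebra, determined by
`ω_T(x) = tr ((T 0 ⊗ ⋯ ⊗ T (n-1)) x)` for `x` in `Mat a n`. -/
def productState : State (UHFAlg a) :=
  State.extend (limCStarNorm a)
    (DirectLimit.Module.lift ℂ ℕ (Mat a) (psiLE a)
      (fun n => (levelState T n).toPositive.toLinearMap)
      (psiLE_compat a (fun n x => (levelState T n).toPositive x) (levelState_psi T)))
    (by
      rw [← map_one (toAlgLim a 0)]
      exact (levelState T 0).map_one')
    (fun x => by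
      obtain ⟨n, x, rfl⟩ := exists_toAlgLim a x
      rw [← map_star, ← map_mul]
      exact (levelState T n).toPositive.map_nonneg (star_mul_self_nonneg x))
    (fun x => by
      obtain ⟨n, x, rfl⟩ := exists_toAlgLim a x
      exact (levelState T n).norm_apply_le x)

lemma productState_toUHF (n : ℕ) (x : Mat a n) :
    (productState T).toPositive (toUHF a n x) = (tensorDensity T n * x).trace :=
  State.extend_toCompl (limCStarNorm a) _ _ _ _ (toAlgLim a n x)

/-- `ω_T(E_{j_1,k_1} ⊗ ⋯ ⊗ E_{j_n,k_n}) = T^{(1)}_{k_1,j_1} ⋯ T^{(n)}_{k_n,j_n}`. -/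
lemma productState_single (n : ℕ) (j k : Idx a n) :
    (productState T).toPositive (toUHF a n (Matrix.single j k 1))
      = ∏ i : Fin n, (T i).1 (k i) (j i) := by
  rw [productState_toUHF, Matrix.trace_mul_comm, Matrix.trace_single_mul, one_smul]
  rfl

/-- The Kronecker product of two matrices, with index `j = b * j' + j''` (from `0`). -/
def kron (n : ℕ) (x : Matrix (Fin (a.1 n)) (Fin (a.1 n)) ℂ)
    (y : Matrix (Fin (b.1 n)) (Fin (b.1 n)) ℂ) :
    Matrix (Fin ((a * b).1 n)) (Fin ((a * b).1 n)) ℂ :=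
  (x ⊗ₖ y).submatrix (finSplit a b n) (finSplit a b n)

/-- The componentwise Kronecker product `T ⊠ R` of sequences of density matrices. -/
def boxtimes : DensitySeq (a * b) := fun n =>
  ⟨kron n (T n).1 (R n).1, ((T n).2.1.kronecker (R n).2.1).submatrix _, by
    rw [kron, trace_submatrix_equiv, Matrix.trace_kronecker, (T n).2.2, (R n).2.2, one_mul]⟩

/-! ### Bijectivity of `φ_{a,b}` -/

variable (a b)

/-- The density matrix `E_{1,1}`. -/
instance : Inhabited (DensitySeq a) := ⟨fun n => ⟨Matrix.single 0 0 1,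
  by
    rw [← Matrix.diagonal_single]
    exact Matrix.PosSemidef.diagonal (fun i => by
      by_cases h : i = 0 <;> simp [h]),
  by simp⟩⟩

instance : Nontrivial (MinTensor (UHFAlg a) (UHFAlg b)) := by
  refine ⟨⟨0, 1, fun h => ?_⟩⟩
  have h1 := (stateTensor (productState (default : DensitySeq a))
    (productState (default : DensitySeq b))).map_one'
  rw [← h, map_zero] at h1
  exact zero_ne_one h1

lemma norm_phiHom (x : UHFAlg (a * b)) : ‖phiHom a b x‖ = ‖x‖ := norm_liftUHF _ _ x

lemma minTmul_mem_closure (x : UHFAlg a) (y : UHFAlg b) :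
    minTmul x y ∈ closure (Set.range (phiHom a b)) := by
  refine isClosed_property ((limCStarNorm a).denseRange_toCompl.prodMap
      (limCStarNorm b).denseRange_toCompl)
    (p := fun z : UHFAlg a × UHFAlg b => minTmul z.1 z.2 ∈ closure (Set.range (phiHom a b)))
    (isClosed_closure.preimage continuous_minTmul) (fun z => subset_closure ?_) (x, y)
  obtain ⟨x, y⟩ := z
  obtain ⟨m, x, rfl⟩ := exists_toAlgLim _ x
  obtain ⟨n, y, rfl⟩ := exists_toAlgLim _ y
  change minTmul (toUHF a m x) (toUHF b n y) ∈ _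
  rw [← toUHF_psiLE a m (max m n) (le_max_left _ _), ← toUHF_psiLE b n (max m n) (le_max_right _ _),
    ← phiHom_kronLevel]
  exact Set.mem_range_self _

lemma denseRange_phiHom : DenseRange (phiHom a b) := by
  let S := (AddMonoidHomClass.toAddMonoidHom (phiHom a b)).range.topologicalClosure
  have hS (z : UHFAlg a ⊗[ℂ] UHFAlg b) : (minNorm (UHFAlg a) (UHFAlg b)).toCompl z ∈ S := by
    induction z with
    | zero => rw [map_zero]; exact S.zero_mem
    | add x y hx hy => rw [map_add]; exact S.add_mem hx hy
    | tmul x y => exact minTmul_mem_closure a b x y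
  intro z
  exact (minNorm (UHFAlg a) (UHFAlg b)).denseRange_toCompl.induction_on (p := fun z => z ∈ S) z
    (AddSubgroup.isClosed_topologicalClosure _) hS

lemma phiHom_bijective : Function.Bijective (phiHom a b) := by
  have hi : Isometry (phiHom a b) :=
    AddMonoidHomClass.isometry_of_norm (phiHom a b) (norm_phiHom a b)
  refine ⟨hi.injective, ?_⟩
  rw [← Set.range_eq_univ, ← hi.isClosedEmbedding.isClosed_range.closure_eq]
  exact (denseRange_phiHom a b).closure_range

/-- The ⋆-isomorphism `φ_{a,b}` from `UHFAlg (a * b)` onto `UHFAlg a ⊗ UHFAlg b`. -/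
def phi : UHFAlg (a * b) ≃⋆ₐ[ℂ] MinTensor (UHFAlg a) (UHFAlg b) :=
  StarAlgEquiv.ofBijective (phiHom a b) (phiHom_bijective a b)

lemma phi_single (n : ℕ) (j k : Idx (a * b) n) :
    phi a b (toUHF (a * b) n (Matrix.single j k 1)) =
      minTmul (toUHF a n (Matrix.single (fun i => (finSplit a b i (j i)).1)
          (fun i => (finSplit a b i (k i)).1) 1))
        (toUHF b n (Matrix.single (fun i => (finSplit a b i (j i)).2)
          (fun i => (finSplit a b i (k i)).2) 1)) := by
  rw [single_eq_kronLevel]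
  exact phiHom_kronLevel a b n _ _

/-! ### The operation `⊗_φ` -/

variable {a b}

/-- `π ⊗_φ ρ = (π ⊗ ρ) ∘ φ_{a,b}` for representations. -/
def ptimesRep {H K : Type} [NormedAddCommGroup H] [InnerProductSpace ℂ H] [CompleteSpace H]
    [NormedAddCommGroup K] [InnerProductSpace ℂ K] [CompleteSpace K]
    (π : UHFAlg a →⋆ₐ[ℂ] (H →L[ℂ] H)) (ρ : UHFAlg b →⋆ₐ[ℂ] (K →L[ℂ] K)) :
    UHFAlg (a * b) →⋆ₐ[ℂ] (HilbertTensor H K →L[ℂ] HilbertTensor H K) :=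
  (repTensor π ρ).comp (phi a b : UHFAlg (a * b) →⋆ₐ[ℂ] MinTensor (UHFAlg a) (UHFAlg b))

/-- `f ⊗_φ g = (f ⊗ g) ∘ φ_{a,b}` for states. -/
def ptimesState (f : State (UHFAlg a)) (g : State (UHFAlg b)) : State (UHFAlg (a * b)) :=
  (stateTensor f g).comp (phi a b : UHFAlg (a * b) →⋆ₐ[ℂ] MinTensor (UHFAlg a) (UHFAlg b))

end UHFAlgebras

end UHF

end

/-!
A representation with a cyclic vector `v` is determined, up to unitary equivalence, by the
functional `x ↦ ⟪v, π(x) v⟫`, because this functional determines the norms `‖π(x) v‖`. If `v` and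
`w` are cyclic for `π` and `ρ`, then `v ⊗ w` is cyclic for `π ⊗ ρ`, hence also for `π ⊗_φ ρ`, as
`φ` is onto. Applied to the GNS vectors this shows that `π_f ⊗_φ π_g` is the GNS representation of
`f ⊗_φ g` for arbitrary states `f` and `g`, so that (ii) reduces to (i). For (i), both states send
the Kronecker product of `x ∈ M_{a 0} ⊗ ⋯ ⊗ M_{a (n-1)}` and `y ∈ M_{b 0} ⊗ ⋯ ⊗ M_{b (n-1)}` to
`ω_T(x) ω_R(y)`, and these products span a dense subspace as `n` varies.
-/

namespace UHF

open scoped TensorProduct Kronecker ComplexOrder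

section CyclicVector

variable {A : Type*} [Semiring A] [StarRing A] [Algebra ℂ A]
  {H : Type*} [NormedAddCommGroup H] [InnerProductSpace ℂ H] [CompleteSpace H]
  {K : Type*} [NormedAddCommGroup K] [InnerProductSpace ℂ K] [CompleteSpace K]

lemma inner_rep_apply_rep_apply (π : A →⋆ₐ[ℂ] (H →L[ℂ] H)) (x y : A) (v w : H) :
    inner ℂ (π x v) (π y w) = inner ℂ v (π (star x * y) w) := by
  rw [map_mul, map_star, mul_apply_eq_comp, ContinuousLinearMap.star_eq_adjoint,
    ContinuousLinearMap.adjoint_inner_right]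

lemma norm_rep_apply_eq_of_inner_eq {π : A →⋆ₐ[ℂ] (H →L[ℂ] H)} {ρ : A →⋆ₐ[ℂ] (K →L[ℂ] K)}
    {v : H} {w : K} (h : ∀ x, inner ℂ v (π x v) = inner ℂ w (ρ x w)) (x : A) :
    ‖π x v‖ = ‖ρ x w‖ := by
  rw [norm_eq_sqrt_re_inner (𝕜 := ℂ), norm_eq_sqrt_re_inner (𝕜 := ℂ),
    inner_rep_apply_rep_apply, inner_rep_apply_rep_apply, h]

/-- The linear map `x ↦ π(x) v` of an algebra onto the orbit of a vector `v` under a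
representation `π`. -/
noncomputable def orbitMap (π : A →⋆ₐ[ℂ] (H →L[ℂ] H)) (v : H) : A →ₗ[ℂ] H :=
  (ContinuousLinearMap.apply ℂ H v).toLinearMap ∘ₗ π.toAlgHom.toLinearMap

lemma orbitMap_apply (π : A →⋆ₐ[ℂ] (H →L[ℂ] H)) (v : H) (x : A) : orbitMap π v x = π x v := rfl

/-- A vector is cyclic for a representation when its orbit (not only the closed span of the
orbit, which amounts to the same) is dense. -/
def IsCyclicVector (π : A →⋆ₐ[ℂ] (H →L[ℂ] H)) (v : H) : Prop := DenseRange (orbitMap π v)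

lemma IsCyclicVector.comp {B : Type*} [Semiring B] [StarRing B] [Algebra ℂ B]
    {π : A →⋆ₐ[ℂ] (H →L[ℂ] H)} {v : H} (hv : IsCyclicVector π v) {φ : B →⋆ₐ[ℂ] A}
    (hφ : Function.Surjective φ) : IsCyclicVector (π.comp φ) v := by
  have orbit_comp : ⇑(orbitMap (π.comp φ) v) = orbitMap π v ∘ φ := rfl
  rwa [IsCyclicVector, orbit_comp, DenseRange, hφ.range_comp]

end CyclicVector

theorem IsCyclicVector.unitarilyEquivalent {A : Type*} [CStarAlgebra A]
    {H : Type*} [NormedAddCommGroup H] [InnerProductSpace ℂ H] [CompleteSpace H]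
    {K : Type*} [NormedAddCommGroup K] [InnerProductSpace ℂ K] [CompleteSpace K]
    {π : A →⋆ₐ[ℂ] (H →L[ℂ] H)} {ρ : A →⋆ₐ[ℂ] (K →L[ℂ] K)} {v : H} {w : K}
    (hv : IsCyclicVector π v) (hw : IsCyclicVector ρ w)
    (h : ∀ x, inner ℂ v (π x v) = inner ℂ w (ρ x w)) : UnitarilyEquivalent π ρ := by
  let U : H ≃ₗᵢ[ℂ] K := (LinearEquiv.refl ℂ A).extendOfIsometry (orbitMap π v) (orbitMap ρ w)
    hv hw fun x => (norm_rep_apply_eq_of_inner_eq h x).symm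
  have hU (x : A) : U (π x v) = ρ x w :=
    (LinearEquiv.refl ℂ A).extendOfIsometry_eq (orbitMap π v) (orbitMap ρ w) hv hw _ x
  refine ⟨U, fun x ξ => ?_⟩
  induction ξ using hv.induction_on with
  | hp => exact isClosed_eq (by fun_prop) (by fun_prop)
  | ih y =>
    rw [orbitMap_apply, ← mul_apply_eq_comp, ← map_mul, hU, hU, map_mul, mul_apply_eq_comp]

section HilbertTensor

variable {H K : Type*} [NormedAddCommGroup H] [InnerProductSpace ℂ H]
  [NormedAddCommGroup K] [InnerProductSpace ℂ K]

lemma continuous_htmul : Continuous fun z : H × K => htmul z.1 z.2 :=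
  (ofAlg H K).continuous.comp (by fun_prop)

lemma dense_span_range_htmul {X Y : Type*} {f : X → H} {g : Y → K} (hf : DenseRange f)
    (hg : DenseRange g) :
    Dense (Submodule.span ℂ (Set.range fun z : X × Y => htmul (f z.1) (g z.2)) :
      Set (HilbertTensor H K)) := by
  set S := Submodule.span ℂ (Set.range fun z : X × Y => htmul (f z.1) (g z.2))
  have htmul_mem (x : H) (y : K) : htmul x y ∈ S.topologicalClosure :=
    isClosed_property (hf.prodMap hg)
      (S.isClosed_topologicalClosure.preimage continuous_htmul)
      (fun z => S.le_topologicalClosure (Submodule.subset_span ⟨z, rfl⟩)) (x, y)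
  have ofAlg_mem (t : H ⊗[ℂ] K) : ofAlg H K t ∈ S.topologicalClosure := by
    induction t with
    | zero => rw [map_zero]; exact zero_mem _
    | add t t' ht ht' => rw [map_add]; exact add_mem ht ht'
    | tmul x y => exact htmul_mem x y
  intro z
  exact isClosed_property denseRange_ofAlg S.isClosed_topologicalClosure ofAlg_mem z

end HilbertTensor

universe u

lemma IsCyclicVector.htmul {A B : Type u} [CStarAlgebra A] [CStarAlgebra B]
    {H K : Type u} [NormedAddCommGroup H] [InnerProductSpace ℂ H] [CompleteSpace H]
    [NormedAddCommGroup K] [InnerProductSpace ℂ K] [CompleteSpace K]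
    {π : A →⋆ₐ[ℂ] (H →L[ℂ] H)} {ρ : B →⋆ₐ[ℂ] (K →L[ℂ] K)} {v : H} {w : K}
    (hv : IsCyclicVector π v) (hw : IsCyclicVector ρ w) :
    IsCyclicVector (repTensor π ρ) (htmul v w) := by
  have span_le : Submodule.span ℂ (Set.range fun z : A × B => UHF.htmul (π z.1 v) (ρ z.2 w)) ≤
      LinearMap.range (orbitMap (repTensor π ρ) (UHF.htmul v w)) := by
    rw [Submodule.span_le]
    rintro _ ⟨⟨x, y⟩, rfl⟩
    refine ⟨minTmul x y, ?_⟩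
    rw [orbitMap_apply, repTensor_minTmul, opTensor_htmul]
  exact (dense_span_range_htmul hv hw).mono span_le

namespace State

section

variable {A : Type*} [CStarAlgebra A] [PartialOrder A] [StarOrderedRing A]

@[ext]
lemma ext {f g : State A} (h : ∀ x, f.toPositive x = g.toPositive x) : f = g := by
  obtain ⟨f, _⟩ := f
  obtain ⟨g, _⟩ := g
  obtain rfl : f = g := DFunLike.ext _ _ h
  rfl

lemma continuous_toPositive (f : State A) : Continuous f.toPositive :=
  AddMonoidHomClass.continuous_of_bound f.toPositive 1 fun x => by
    simpa only [one_mul] using f.norm_apply_le x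

lemma gnsRep_apply_gnsVector (f : State A) (x : A) :
    f.gnsRep x f.gnsVector = ((f.toPositive.toPreGNS x : f.toPositive.PreGNS) : f.GNS) := by
  change f.toPositive.gnsNonUnitalStarAlgHom x _ = _
  rw [gnsVector, PositiveLinearMap.gnsNonUnitalStarAlgHom_apply_coe]
  simp

lemma isCyclicVector_gnsVector (f : State A) : IsCyclicVector f.gnsRep f.gnsVector := by
  have orbit_eq : ⇑(orbitMap f.gnsRep f.gnsVector) =
      fun x => ((f.toPositive.toPreGNS x : f.toPositive.PreGNS) : f.GNS) :=
    funext f.gnsRep_apply_gnsVector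
  rw [IsCyclicVector, orbit_eq]
  exact UniformSpace.Completion.denseRange_coe.comp f.toPositive.toPreGNS.surjective.denseRange
    (UniformSpace.Completion.continuous_coe _)

theorem unitarilyEquivalent_gnsRep
    {H : Type*} [NormedAddCommGroup H] [InnerProductSpace ℂ H] [CompleteSpace H]
    (f : State A) {π : A →⋆ₐ[ℂ] (H →L[ℂ] H)} {v : H} (hv : IsCyclicVector π v)
    (hf : ∀ x, f.toPositive x = inner ℂ v (π x v)) : UnitarilyEquivalent π f.gnsRep :=
  hv.unitarilyEquivalent f.isCyclicVector_gnsVector fun x => by rw [f.inner_gnsVector, hf]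

end

theorem unitarilyEquivalent_repTensor_comp_gnsRep {A B : Type u} {C : Type*}
    [CStarAlgebra A] [PartialOrder A] [StarOrderedRing A]
    [CStarAlgebra B] [PartialOrder B] [StarOrderedRing B]
    [CStarAlgebra C] [PartialOrder C] [StarOrderedRing C]
    (f : State A) (g : State B) {φ : C →⋆ₐ[ℂ] MinTensor A B} (hφ : Function.Surjective φ) :
    UnitarilyEquivalent ((repTensor f.gnsRep g.gnsRep).comp φ) ((stateTensor f g).comp φ).gnsRep :=
  unitarilyEquivalent_gnsRep _
    ((f.isCyclicVector_gnsVector.htmul g.isCyclicVector_gnsVector).comp hφ) fun _ => rfl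

end State

section UHFAlgebras

variable {a b : Seq2}

theorem unitarilyEquivalent_ptimesRep_gnsRep (f : State (UHFAlg a)) (g : State (UHFAlg b)) :
    UnitarilyEquivalent (ptimesRep f.gnsRep g.gnsRep) (ptimesState f g).gnsRep :=
  State.unitarilyEquivalent_repTensor_comp_gnsRep f g (phi a b).surjective

namespace State

lemma ext_toUHF {f g : State (UHFAlg a)}
    (h : ∀ n x, f.toPositive (toUHF a n x) = g.toPositive (toUHF a n x)) : f = g := by
  ext x
  induction x using (limCStarNorm a).denseRange_toCompl.induction_on with
  | hp => exact isClosed_eq f.continuous_toPositive g.continuous_toPositive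
  | ih x =>
    obtain ⟨n, x, rfl⟩ := exists_toAlgLim _ x
    exact h n x

lemma ext_kronLevel {f g : State (UHFAlg (a * b))}
    (h : ∀ n x y, f.toPositive (toUHF (a * b) n (kronLevel a b n (x ⊗ₜ y))) =
      g.toPositive (toUHF (a * b) n (kronLevel a b n (x ⊗ₜ y)))) : f = g :=
  ext_toUHF fun n => eq_of_kronLevel
    (f.toPositive.toLinearMap.comp (toUHF (a * b) n).toAlgHom.toLinearMap).toAddMonoidHom
    (g.toPositive.toLinearMap.comp (toUHF (a * b) n).toAlgHom.toLinearMap).toAddMonoidHom (h n)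

end State

lemma ptimesState_kronLevel (f : State (UHFAlg a)) (g : State (UHFAlg b)) (n : ℕ)
    (x : Mat a n) (y : Mat b n) :
    (ptimesState f g).toPositive (toUHF (a * b) n (kronLevel a b n (x ⊗ₜ y))) =
      f.toPositive (toUHF a n x) * g.toPositive (toUHF b n y) := by
  rw [← stateTensor_minTmul, ← phiHom_kronLevel]
  rfl

variable (T : DensitySeq a) (R : DensitySeq b)

lemma tensorDensity_boxtimes (n : ℕ) :
    tensorDensity (boxtimes T R) n = (tensorDensity T n ⊗ₖ tensorDensity R n).submatrix
      (idxSplit a b n) (idxSplit a b n) := by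
  ext j k
  exact Finset.prod_mul_distrib (s := Finset.univ)
    (f := fun i : Fin n => (T i).1 (finSplit a b i (j i)).1 (finSplit a b i (k i)).1)
    (g := fun i : Fin n => (R i).1 (finSplit a b i (j i)).2 (finSplit a b i (k i)).2)

lemma productState_boxtimes_kronLevel (n : ℕ) (x : Mat a n) (y : Mat b n) :
    (productState (boxtimes T R)).toPositive (toUHF (a * b) n (kronLevel a b n (x ⊗ₜ y))) =
      (productState T).toPositive (toUHF a n x) * (productState R).toPositive (toUHF b n y) := by
  rw [productState_toUHF, productState_toUHF, productState_toUHF, kronLevel_tmul,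
    tensorDensity_boxtimes, Matrix.submatrix_mul_equiv, trace_submatrix_equiv,
    ← Matrix.mul_kronecker_mul, Matrix.trace_kronecker]

theorem ptimesState_productState :
    ptimesState (productState T) (productState R) = productState (boxtimes T R) :=
  State.ext_kronLevel fun n x y => by
    rw [ptimesState_kronLevel, productState_boxtimes_kronLevel]

end UHFAlgebras

end UHF

theorem mainTheorem2 (a b : UHF.Seq2) (T : UHF.DensitySeq a) (R : UHF.DensitySeq b) :
    UHF.ptimesState (UHF.productState T) (UHF.productState R)
        = UHF.productState (UHF.boxtimes T R) ∧
      UHF.UnitarilyEquivalent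
        (UHF.ptimesRep (UHF.productState T).gnsRep (UHF.productState R).gnsRep)
        (UHF.productState (UHF.boxtimes T R)).gnsRep := by
  refine ⟨UHF.ptimesState_productState T R, ?_⟩
  rw [← UHF.ptimesState_productState]
  exact UHF.unitarilyEquivalent_ptimesRep_gnsRep _ _
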